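/- \textbf{Theorem (asymptotic normality of the plug-in reward in the linear model).} Let $A$ be a random vector in $\mathbb{R}^{D}$, $H=(H_j)_{j\in J}$ a family of random vectors $H_j\in\mathbb{R}^{d_j}$, and $Y$ a real random variable. Fix a finite subset $\pi\subseteq J$, and put $H_\pi=(H_j)_{j\in\pi}$, $X=(A,H_\pi)$ and $M=(A,H_\pi,Y)$ (vertically stacked). One of the coordinates of $A$ may be the constant $1$, so that an intercept is allowed. Let $\Sigma=\mathbb{E}[MM^\top]$, with blocks $\Sigma_{X,X}=\mathbb{E}[XX^\top]$ and $\Sigma_{X,Y}=\mathbb{E}[XY]$. Assume that all coordinates of $M$ have a finite fourth moment, that $\Sigma_{X,X}$ is invertible, and that the linear model holds: $\mathbb{E}[Y\mid A,H_\pi]=\gamma^\top A+\beta^\top H_\pi$ almost surely for some vectors $\gamma,\beta$; write $\theta=(\gamma,\beta)$. Let $$R=\mathbb{E}\bigl[(\mathbb{E}[Y\mid A,H_\pi])^2\bigr].$$ Let $M_1,M_2,\dots$ be i.i.d. copies of $M$, and set $$\hat S=\frac1n\sum_{k=1}^n M_kM_k^\top ,\qquad \hat R=\hat S_{X,Y}^\top\,\hat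 S_{X,X}^{-1}\,\hat S_{X,Y},$$ where the inverse of a singular matrix is read as $0$. Let $\mathrm{vec}$ stack the columns of a matrix. For blocks $U,V$ of coordinates let $P_{U,V}$ be the $0$--$1$ matrix such that, for every matrix $S$ of the size of $\Sigma$, $P_{U,V}\,\mathrm{vec}(S_{U,V})$ is $\mathrm{vec}(S)$ with all entries outside the $(U,V)$ block (rows $U$, columns $V$) replaced by zero. Let $\mathrm{Var}$ of a random vector denote its covariance matrix, let $\otimes$ be the Kronecker product, and put $$\alpha=2P_{X,Y}\,\theta-P_{X,X}\bigl(\theta^\top\otimes\Sigma_{X,X}^{-1}\bigr)^\top\Sigma_{X,Y},\qquad \sigma^2=\alpha^\top\,\mathrm{Var}\bigl(\mathrm{vec}(MM^\top)\bigr)\,\alpha .$$ Then $\theta=\Sigma_{X,X}^{-1}\Sigma_{X,Y}$, $R=\theta^\top\Sigma_{X,X}\theta=\Sigma_{X,Y}^\top\Sigma_{X,X}^{-1}\Sigma_{X,Y}$, $\sigma^2\ge 0$, and $$\sqrt n\,\bigl(\hat R-R\bigr)\ \xrightarrow{\ d\ }\ \mathcal N(0,\sigma^2)\qquad(n\to\infty),$$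 where $\mathcal N(0,0)$ is the point mass at $0$. -/

import Mathlib

open MeasureTheory ProbabilityTheory Filter Matrix
open scoped Kronecker

namespace LinReward

/-- Coordinates of `X = (A, H_π)`. The AI signal `A` has coordinates `ιA`; the human signal is
`H = (H_j)_{j : J}` with `H_j` a vector of length `d j`, and `π` is the set of queried factors. -/
abbrev XIdx (ιA : Type*) {J : Type*} (d : J → ℕ) (π : Finset J) :=
  ιA ⊕ ((j : π) × Fin (d j))

/-- Coordinates of `M = (A, H_π, Y)`. -/
abbrev MIdx (ιA : Type*) {J : Type*} (d : J → ℕ) (π : Finset J) :=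
  XIdx ιA d π ⊕ Unit

section Signals

variable {Ω ιA J : Type*} {d : J → ℕ}

/-- The random vector `X = (A, H_π)`. -/
def stackX (π : Finset J) (A : Ω → ιA → ℝ) (H : Ω → (j : J) → Fin (d j) → ℝ) :
    Ω → XIdx ιA d π → ℝ :=
  fun ω => Sum.elim (A ω) (fun q => H ω q.1 q.2)

/-- The random vector `M = (A, H_π, Y)`. -/
def stackM (π : Finset J) (A : Ω → ιA → ℝ) (H : Ω → (j : J) → Fin (d j) → ℝ) (Y : Ω → ℝ) :
    Ω → MIdx ιA d π → ℝ :=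
  fun ω => Sum.elim (stackX π A H ω) (fun _ => Y ω)

variable [MeasurableSpace Ω]

/-- The conditional expectation `𝔼[Y | A, H_π]`. -/
noncomputable def condMean (π : Finset J) (A : Ω → ιA → ℝ) (H : Ω → (j : J) → Fin (d j) → ℝ)
    (Y : Ω → ℝ) (μ : Measure Ω) : Ω → ℝ :=
  μ[Y | MeasurableSpace.comap (stackX π A H) inferInstance]

/-- The non-adaptive reward `R_π = 𝔼[(𝔼[Y | A, H_π])²]`. -/
noncomputable def reward (π : Finset J) (A : Ω → ιA → ℝ) (H : Ω → (j : J) → Fin (d j) → ℝ)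
    (Y : Ω → ℝ) (μ : Measure Ω) : ℝ :=
  ∫ ω, (condMean π A H Y μ ω) ^ 2 ∂μ

end Signals

section Moments

variable {Ω ι : Type*}

/-- The rank-one random matrix `M Mᵀ`. -/
def outer (M : Ω → ι → ℝ) (ω : Ω) : Matrix ι ι ℝ := vecMulVec (M ω) (M ω)

/-- `Σ = 𝔼[M Mᵀ]`, entrywise. -/
noncomputable def secondMoment [MeasurableSpace Ω] (M : Ω → ι → ℝ) (μ : Measure Ω) :
    Matrix ι ι ℝ :=
  Matrix.of fun i j => ∫ ω, outer M ω i j ∂μ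

/-- `Ŝ = n⁻¹ ∑_{k < n} M_k M_kᵀ`. -/
noncomputable def sampleMoment (M : ℕ → Ω → ι → ℝ) (n : ℕ) (ω : Ω) : Matrix ι ι ℝ :=
  (n : ℝ)⁻¹ • ∑ k ∈ Finset.range n, outer (M k) ω

/-- The covariance matrix `Var(V)` of a random vector `V`. -/
noncomputable def covMat [MeasurableSpace Ω] (V : Ω → ι → ℝ) (μ : Measure Ω) : Matrix ι ι ℝ :=
  Matrix.of fun p q => cov[fun ω => V ω p, fun ω => V ω q; μ]

end Moments

section Blocks

variable {κ : Type*}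

/-- The block `S_{X,X}` of a matrix indexed by the coordinates of `(X, Y)`. -/
def blockXX (S : Matrix (κ ⊕ Unit) (κ ⊕ Unit) ℝ) : Matrix κ κ ℝ := S.toBlocks₁₁

/-- The block `S_{X,Y}`, a matrix with one column. -/
def blockXY (S : Matrix (κ ⊕ Unit) (κ ⊕ Unit) ℝ) : Matrix κ Unit ℝ := S.toBlocks₁₂

/-- The plug-in functional `S ↦ S_{X,Y}ᵀ S_{X,X}⁻¹ S_{X,Y}`, read off as a real number. -/
noncomputable def plugIn [Fintype κ] [DecidableEq κ] (S : Matrix (κ ⊕ Unit) (κ ⊕ Unit) ℝ) : ℝ :=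
  ((blockXY S)ᵀ * (blockXX S)⁻¹ * blockXY S) () ()

/-- The expander matrix of the block with rows `r` and columns `c`: applied to the (column-stacked)
`vec` of that block of a matrix `S`, it gives `vec S` with all entries outside the block
replaced by zero. -/
def expander {ι ρ γ : Type*} [DecidableEq ι] (r : ρ → ι) (c : γ → ι) :
    Matrix (ι × ι) (γ × ρ) ℝ :=
  (1 : Matrix (ι × ι) (ι × ι) ℝ).submatrix id (Prod.map c r)

/-- `P_{X,X}`. -/
def expandXX (κ : Type*) [DecidableEq κ] :
    Matrix ((κ ⊕ Unit) × (κ ⊕ Unit)) (κ × κ) ℝ :=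
  expander Sum.inl Sum.inl

/-- `P_{X,Y}`. -/
def expandXY (κ : Type*) [DecidableEq κ] :
    Matrix ((κ ⊕ Unit) × (κ ⊕ Unit)) (Unit × κ) ℝ :=
  expander Sum.inl Sum.inr

/-- `α = 2 P_{X,Y} θ - P_{X,X} (θᵀ ⊗ S_{X,X}⁻¹)ᵀ S_{X,Y}`, where `θ` and `S_{X,Y}` are columns,
identified with their `vec`. -/
noncomputable def alpha [Fintype κ] [DecidableEq κ] (S : Matrix (κ ⊕ Unit) (κ ⊕ Unit) ℝ)
    (θ : κ → ℝ) : (κ ⊕ Unit) × (κ ⊕ Unit) → ℝ :=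
  (2 : ℝ) • (expandXY κ *ᵥ vec (replicateCol Unit θ)) -
    expandXX κ *ᵥ ((replicateRow Unit θ ⊗ₖ (blockXX S)⁻¹)ᵀ *ᵥ vec (blockXY S))

/-- `σ² = αᵀ Var(vec(M Mᵀ)) α`. -/
noncomputable def asympVar {Ω : Type*} [MeasurableSpace Ω] [Fintype κ] [DecidableEq κ]
    (M : Ω → κ ⊕ Unit → ℝ) (μ : Measure Ω) (θ : κ → ℝ) : ℝ :=
  alpha (secondMoment M μ) θ ⬝ᵥ
    (covMat (fun ω => vec (outer M ω)) μ *ᵥ alpha (secondMoment M μ) θ)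

end Blocks

end LinReward

open scoped Topology

/-! The delta method is applied through an exact identity, with no differentiation. For symmetric
`S` with invertible X-block and any `θ`, put `r = S_XY - S_XX θ`; completing the square gives
`plugIn S = linPart θ S + rᵀ S_XX⁻¹ r` (`plugIn_eq_linPart_add`), where `linPart θ` is linear in
`S`. The linear model forces `r = 0` at the population matrix (`blockXX_mulVec_eq_vecXY`), so there
the quadratic term vanishes to second order.

Since `linPart θ S = α ⬝ vec S` (`alpha_dotProduct_vec`), the scalar central limit theorem handles
the linear term and produces `σ²`. Each coordinate of the sample residual is a mean of centred
i.i.d. square-integrable variables, so `√n r_i²` tends to 0 in L¹; the inverse sample block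
converges almost surely by the strong law. The remainder is therefore negligible, and Slutsky's
theorem concludes. -/

namespace LinReward

/-! ### Exact expansion of the plug-in functional -/

section Algebra

variable {κ : Type*} [Fintype κ]

/-- The vector `S_{X,Y}`. -/
def vecXY (S : Matrix (κ ⊕ Unit) (κ ⊕ Unit) ℝ) : κ → ℝ := fun i => S (Sum.inl i) (Sum.inr ())

/-- The derivative of `plugIn` at a second-moment matrix with regression vector `θ`. -/
def linPart (θ : κ → ℝ) (S : Matrix (κ ⊕ Unit) (κ ⊕ Unit) ℝ) : ℝ :=
  2 * (θ ⬝ᵥ vecXY S) - θ ⬝ᵥ (blockXX S *ᵥ θ)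

/-- The normal-equation residual `S_{X,Y} - S_{X,X} θ`. -/
def normalResidual (θ : κ → ℝ) (S : Matrix (κ ⊕ Unit) (κ ⊕ Unit) ℝ) : κ → ℝ :=
  vecXY S - blockXX S *ᵥ θ

variable [DecidableEq κ]

lemma plugIn_eq_dotProduct (S : Matrix (κ ⊕ Unit) (κ ⊕ Unit) ℝ) :
    plugIn S = vecXY S ⬝ᵥ ((blockXX S)⁻¹ *ᵥ vecXY S) := by
  rw [dotProduct_mulVec]
  simp [plugIn, Matrix.mul_apply, dotProduct, vecMul, vecXY, blockXY, toBlocks₁₂]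

/-- Transposed expanders extract blocks, and `(θᵀ ⊗ S_XX⁻¹) vec T_XX = vec (S_XX⁻¹ T_XX θ)`. Pairing
with `S_XY` and using symmetry of `S_XX⁻¹` leaves `θᵀ T_XXᵀ θ = θᵀ T_XX θ`, so `T` itself need not
be symmetric. -/
lemma alpha_dotProduct_vec {S : Matrix (κ ⊕ Unit) (κ ⊕ Unit) ℝ} (hsymm : (blockXX S)ᵀ = blockXX S)
    {θ : κ → ℝ} (hθ : (blockXX S)⁻¹ *ᵥ vecXY S = θ) (T : Matrix (κ ⊕ Unit) (κ ⊕ Unit) ℝ) :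
    alpha S θ ⬝ᵥ vec T = linPart θ T := by
  have hinv : ((blockXX S)⁻¹)ᵀ = (blockXX S)⁻¹ := by rw [transpose_nonsing_inv, hsymm]
  have hXY : (expandXY κ)ᵀ *ᵥ vec T = vec (blockXY T) := by
    ext ⟨a, i⟩
    simp [expandXY, expander, mulVec, dotProduct, Matrix.one_apply, blockXY, toBlocks₁₂]
  have hXX : (expandXX κ)ᵀ *ᵥ vec T = vec (blockXX T) := by
    ext ⟨a, i⟩
    simp [expandXX, expander, mulVec, dotProduct, Matrix.one_apply, blockXX, toBlocks₁₁]
  have h1 : (expandXY κ *ᵥ vec (replicateCol Unit θ)) ⬝ᵥ vec T = θ ⬝ᵥ vecXY T := by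
    rw [dotProduct_comm, dotProduct_mulVec, ← mulVec_transpose, hXY, vec_dotProduct_vec]
    simp [Matrix.trace, Matrix.mul_apply, dotProduct, vecXY, blockXY, toBlocks₁₂, mul_comm]
  have h2 : (expandXX κ *ᵥ ((replicateRow Unit θ ⊗ₖ (blockXX S)⁻¹)ᵀ *ᵥ vec (blockXY S))) ⬝ᵥ vec T
      = θ ⬝ᵥ (blockXX T *ᵥ θ) := by
    rw [dotProduct_comm, dotProduct_mulVec, ← mulVec_transpose, hXX, dotProduct_mulVec,
      vecMul_transpose, kronecker_mulVec_vec, vec_dotProduct_vec]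
    have : ((blockXX S)⁻¹ * blockXX T * (replicateRow Unit θ)ᵀ)ᵀ * blockXY S
        = replicateRow Unit θ * (blockXX T)ᵀ * ((blockXX S)⁻¹ * blockXY S) := by
      simp only [transpose_mul, hinv, transpose_transpose, Matrix.mul_assoc]
    rw [this]
    have hcol : (blockXX S)⁻¹ * blockXY S = replicateCol Unit θ := by
      ext i u
      rw [← hθ]
      simp [Matrix.mul_apply, mulVec, dotProduct, vecXY, blockXY, toBlocks₁₂]
    rw [hcol, dotProduct_mulVec, ← mulVec_transpose, dotProduct_comm]
    rw [Matrix.mul_assoc]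
    simp [Matrix.trace, Matrix.mul_apply, dotProduct, mulVec]
  rw [alpha, sub_dotProduct, smul_dotProduct, h1, h2, linPart, smul_eq_mul]

/-- Substitute `S_XY = r + S_XX θ` and expand the quadratic form. The vector `θ` is free, so the
population `θ` can be used at sample matrices. -/
lemma plugIn_eq_linPart_add {S : Matrix (κ ⊕ Unit) (κ ⊕ Unit) ℝ}
    (hsymm : (blockXX S)ᵀ = blockXX S) (hS : IsUnit (blockXX S).det) (θ : κ → ℝ) :
    plugIn S = linPart θ S +
      normalResidual θ S ⬝ᵥ ((blockXX S)⁻¹ *ᵥ normalResidual θ S) := by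
  have h1 : (blockXX S)⁻¹ *ᵥ (blockXX S *ᵥ θ) = θ := by
    rw [mulVec_mulVec, nonsing_inv_mul _ hS, one_mulVec]
  have h2 : (blockXX S *ᵥ θ) ⬝ᵥ ((blockXX S)⁻¹ *ᵥ vecXY S) = θ ⬝ᵥ vecXY S := by
    rw [← vecMul_transpose, hsymm, ← dotProduct_mulVec, mulVec_mulVec, mul_nonsing_inv _ hS,
      one_mulVec]
  rw [plugIn_eq_dotProduct, normalResidual, mulVec_sub, h1, sub_dotProduct, dotProduct_sub,
    dotProduct_sub, h2, linPart, dotProduct_comm (vecXY S) θ,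
    dotProduct_comm (blockXX S *ᵥ θ) θ]
  ring

/-- Inversion may be discontinuous at singular matrices, but `det⁻¹ • adjugate`, with `0⁻¹ = 0`, is
measurable everywhere. -/
lemma measurable_plugIn :
    Measurable fun S : κ ⊕ Unit → κ ⊕ Unit → ℝ => plugIn (Matrix.of S) := by
  have hc : Continuous fun S : κ ⊕ Unit → κ ⊕ Unit → ℝ => blockXX (Matrix.of S) :=
    continuous_pi fun i => continuous_pi fun j =>
      (continuous_apply (Sum.inl j)).comp (continuous_apply (Sum.inl i))
  have hdet := hc.matrix_det.measurable
  have hadj (i j : κ) : Measurable fun S : κ ⊕ Unit → κ ⊕ Unit → ℝ =>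
      (blockXX (Matrix.of S)).adjugate i j := (hc.matrix_adjugate.matrix_elem i j).measurable
  have hrow (i : κ) : Measurable fun S : κ ⊕ Unit → κ ⊕ Unit → ℝ => S (Sum.inl i) (Sum.inr ()) := by
    fun_prop
  have heq (S : κ ⊕ Unit → κ ⊕ Unit → ℝ) : plugIn (Matrix.of S) =
      ∑ i, S (Sum.inl i) (Sum.inr ()) * ∑ j, (blockXX (Matrix.of S)).det⁻¹ *
        (blockXX (Matrix.of S)).adjugate i j * S (Sum.inl j) (Sum.inr ()) := by
    simp only [plugIn_eq_dotProduct, dotProduct, mulVec, inv_def, Ring.inverse_eq_inv',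
      Matrix.smul_apply, smul_eq_mul, vecXY, Matrix.of_apply]
  simp only [heq]
  exact Finset.measurable_fun_sum _ fun i _ => (hrow i).mul <|
    Finset.measurable_fun_sum _ fun j _ => (hdet.inv.mul (hadj i j)).mul (hrow j)

lemma tendsto_blockXX_inv {S : ℕ → Matrix (κ ⊕ Unit) (κ ⊕ Unit) ℝ}
    {S₀ : Matrix (κ ⊕ Unit) (κ ⊕ Unit) ℝ} (hS₀ : IsUnit (blockXX S₀).det)
    (h : ∀ i j, Tendsto (fun n => S n i j) atTop (𝓝 (S₀ i j))) :
    Tendsto (fun n => (blockXX (S n))⁻¹) atTop (𝓝 (blockXX S₀)⁻¹) ∧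
      ∀ᶠ n in atTop, IsUnit (blockXX (S n)).det := by
  have hb : Tendsto (fun n => blockXX (S n)) atTop (𝓝 (blockXX S₀)) :=
    tendsto_pi_nhds.2 fun i => tendsto_pi_nhds.2 fun j => h _ _
  constructor
  · refine (continuousAt_matrix_inv _ ?_).tendsto.comp hb
    rw [Ring.inverse_eq_inv']
    exact continuousAt_inv₀ hS₀.ne_zero
  · have hd : Tendsto (fun n => (blockXX (S n)).det) atTop (𝓝 (blockXX S₀).det) :=
      (continuous_id.matrix_det.tendsto _).comp hb
    filter_upwards [hd.eventually_ne hS₀.ne_zero] with n hn using hn.isUnit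

end Algebra

/-! ### Squared sample means -/

section Probability

variable {Ω : Type*} [MeasurableSpace Ω] {μ : Measure Ω} [IsProbabilityMeasure μ]

/-- The squared mean of centred i.i.d. variables is `o(1/√n)` in probability. -/
lemma tendstoInMeasure_sqrt_mul_sq_mean {ξ : ℕ → Ω → ℝ} (hξ : ∀ k, MemLp (ξ k) 2 μ)
    (h0 : ∀ k, ∫ ω, ξ k ω ∂μ = 0) (hindep : iIndepFun ξ μ)
    (hident : ∀ k, IdentDistrib (ξ k) (ξ 0) μ μ) :
    TendstoInMeasure μ (fun (n : ℕ) ω => √(n : ℝ) * ((n : ℝ)⁻¹ * ∑ k ∈ Finset.range n, ξ k ω) ^ 2)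
      atTop (fun _ => 0) := by
  have hL2 (n : ℕ) : MemLp (fun ω => ∑ k ∈ Finset.range n, ξ k ω) 2 μ :=
    memLp_finsetSum _ fun k _ => hξ k
  have hsq (n : ℕ) : ∫ ω, (∑ k ∈ Finset.range n, ξ k ω) ^ 2 ∂μ = n * Var[ξ 0; μ] := by
    have hv := variance_of_integral_eq_zero (hL2 n).aemeasurable
      (by rw [integral_finsetSum _ fun k _ => (hξ k).integrable (by norm_num)]; simp [h0])
    rw [← hv]
    have := IndepFun.variance_sum (μ := μ) (s := Finset.range n) (X := ξ) (fun k _ => hξ k)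
      (fun i _ j _ hij => hindep.indepFun hij)
    rw [← Finset.sum_fn, this]
    simp [fun k => (hident k).variance_eq]
  refine tendstoInMeasure_of_tendsto_eLpNorm (p := 1) one_ne_zero
    (fun n => (((hL2 n).aestronglyMeasurable.const_mul _).pow 2).const_mul _)
    aestronglyMeasurable_const ?_
  -- The L¹ norm is `√n * n⁻² * (n * Var) = Var / √n`; for `n = 0` both sides are 0 by the
  -- convention on inverses.
  have hval (n : ℕ) : eLpNorm ((fun ω => √(n : ℝ) * ((n : ℝ)⁻¹ * ∑ k ∈ Finset.range n, ξ k ω) ^ 2)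
      - fun _ => 0) 1 μ = ENNReal.ofReal ((√(n : ℝ))⁻¹ * Var[ξ 0; μ]) := by
    have hint : Integrable (fun ω => √(n : ℝ) * ((n : ℝ)⁻¹ * ∑ k ∈ Finset.range n, ξ k ω) ^ 2) μ :=
      (((hL2 n).const_mul _).integrable_sq).const_mul _
    have h1 : (fun ω => √(n : ℝ) * ((n : ℝ)⁻¹ * ∑ k ∈ Finset.range n, ξ k ω) ^ 2) - (fun _ => 0)
        = fun ω => √(n : ℝ) * ((n : ℝ)⁻¹ * ∑ k ∈ Finset.range n, ξ k ω) ^ 2 := by ext; simp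
    rw [h1, eLpNorm_one_eq_lintegral_enorm, ← ofReal_integral_norm_eq_lintegral_enorm hint]
    congr 1
    have h2 : ∀ ω, ‖√(n : ℝ) * ((n : ℝ)⁻¹ * ∑ k ∈ Finset.range n, ξ k ω) ^ 2‖
        = √(n : ℝ) * ((n : ℝ)⁻¹) ^ 2 * (∑ k ∈ Finset.range n, ξ k ω) ^ 2 := fun ω => by
      rw [Real.norm_of_nonneg (by positivity)]; ring
    simp_rw [h2]
    rw [integral_const_mul, hsq]
    rcases Nat.eq_zero_or_pos n with rfl | hn
    · simp
    · have : (0 : ℝ) < n := by exact_mod_cast hn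
      field_simp
      rw [Real.sq_sqrt this.le]
  simp_rw [hval]
  rw [← ENNReal.ofReal_zero]
  refine ENNReal.tendsto_ofReal ?_
  have : Tendsto (fun n : ℕ => (√(n : ℝ))⁻¹) atTop (𝓝 0) :=
    tendsto_inv_atTop_zero.comp (Real.tendsto_sqrt_atTop.comp tendsto_natCast_atTop_atTop)
  simpa using this.mul_const (Var[ξ 0; μ])

end Probability

/-! ### Linear functionals of `M Mᵀ` and their moments -/

section Functionals

variable {ι : Type*} [Fintype ι]

lemma exists_coeff_of_linear [DecidableEq ι] (L : Matrix ι ι ℝ →ₗ[ℝ] ℝ) :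
    ∃ c : ι × ι → ℝ, ∀ T, L T = c ⬝ᵥ vec T := by
  -- `vec` stacks columns, so the first component of `p` is the column index; hence the swap.
  refine ⟨fun p => L (Matrix.single p.2 p.1 1), fun T => ?_⟩
  conv_lhs => rw [matrix_eq_sum_single T]
  simp only [map_sum, dotProduct, Fintype.sum_prod_type]
  rw [Finset.sum_comm]
  refine Finset.sum_congr rfl fun j _ => Finset.sum_congr rfl fun i _ => ?_
  have : Matrix.single i j (T i j) = T i j • Matrix.single i j (1 : ℝ) := by simp
  rw [this, map_smul, smul_eq_mul, mul_comm]
  rfl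

lemma measurable_dotProduct_vec (c : ι × ι → ℝ) :
    Measurable fun m : ι → ℝ => c ⬝ᵥ vec (vecMulVec m m) := by
  simp only [dotProduct, vec, vecMulVec_apply]
  fun_prop

lemma dotProduct_vec_sampleMoment {Ω : Type*} (c : ι × ι → ℝ) (M : ℕ → Ω → ι → ℝ) (n : ℕ) (ω : Ω) :
    c ⬝ᵥ vec (sampleMoment M n ω) =
      (n : ℝ)⁻¹ * ∑ k ∈ Finset.range n, c ⬝ᵥ vec (outer (M k) ω) := by
  rw [sampleMoment, vec_smul, vec_sum, dotProduct_smul, dotProduct_sum, smul_eq_mul]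

omit [Fintype ι] in
lemma transpose_sampleMoment {Ω : Type*} (M : ℕ → Ω → ι → ℝ) (n : ℕ) (ω : Ω) :
    (sampleMoment M n ω)ᵀ = sampleMoment M n ω := by
  simp [sampleMoment, transpose_sum, outer, transpose_vecMulVec]

variable {Ω : Type*} [MeasurableSpace Ω] {μ : Measure Ω}

omit [Fintype ι] in
lemma transpose_secondMoment (M : Ω → ι → ℝ) : (secondMoment M μ)ᵀ = secondMoment M μ := by
  ext i j
  simp [secondMoment, outer, vecMulVec_apply, mul_comm]

omit [Fintype ι] in
-- Hölder with `1/4 + 1/4 = 1/2`: fourth moments of `M` give the second moments of `M Mᵀ` that the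
-- central limit theorem needs.
lemma memLp_outer {M : Ω → ι → ℝ} (h : ∀ i, MemLp (fun ω => M ω i) 4 μ) (i j : ι) :
    MemLp (fun ω => outer M ω i j) 2 μ := by
  have : ENNReal.HolderTriple 4 4 2 := ⟨by
    rw [← two_mul, show (4 : ENNReal) = 2 * 2 by norm_num, ENNReal.mul_inv (by simp) (by simp),
      ← mul_assoc, ENNReal.mul_inv_cancel (by simp) (by simp), one_mul]⟩
  exact (h j).mul' (h i)

lemma memLp_dotProduct_vec_outer {M : Ω → ι → ℝ} (h : ∀ i, MemLp (fun ω => M ω i) 4 μ)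
    (c : ι × ι → ℝ) : MemLp (fun ω => c ⬝ᵥ vec (outer M ω)) 2 μ :=
  memLp_finsetSum _ fun p _ => (memLp_outer h p.2 p.1).const_mul (c p)

variable [IsProbabilityMeasure μ]

lemma integral_dotProduct_vec_outer {M : Ω → ι → ℝ} (h : ∀ i, MemLp (fun ω => M ω i) 4 μ)
    (c : ι × ι → ℝ) :
    ∫ ω, c ⬝ᵥ vec (outer M ω) ∂μ = c ⬝ᵥ vec (secondMoment M μ) := by
  simp only [dotProduct, vec]
  rw [integral_finsetSum _ fun p _ =>
    ((memLp_outer h p.2 p.1).integrable (by norm_num)).const_mul (c p)]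
  exact Finset.sum_congr rfl fun p _ => integral_const_mul _ _

lemma variance_dotProduct_vec_outer {M : Ω → ι → ℝ} (h : ∀ i, MemLp (fun ω => M ω i) 4 μ)
    (c : ι × ι → ℝ) :
    Var[fun ω => c ⬝ᵥ vec (outer M ω); μ] =
      c ⬝ᵥ (covMat (fun ω => vec (outer M ω)) μ *ᵥ c) := by
  simp only [dotProduct, vec]
  rw [variance_fun_sum fun p => (memLp_outer h p.2 p.1).const_mul (c p)]
  simp only [covariance_const_mul_left, covariance_const_mul_right, mulVec, dotProduct,
    Finset.mul_sum, covMat, Matrix.of_apply]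
  exact Finset.sum_congr rfl fun p _ => Finset.sum_congr rfl fun q _ => by
    simp only [vec]
    ring

end Functionals

/-! ### Limit theorems for the sample second moments -/

section Sample

variable {ι : Type*} [Fintype ι]
  {Ω₀ : Type*} [MeasurableSpace Ω₀] {μ₀ : Measure Ω₀} [IsProbabilityMeasure μ₀] {M₀ : Ω₀ → ι → ℝ}
  {Ω : Type*} [MeasurableSpace Ω] {μ : Measure Ω} [IsProbabilityMeasure μ] {M : ℕ → Ω → ι → ℝ}

omit [IsProbabilityMeasure μ₀] [IsProbabilityMeasure μ] in
lemma identDistrib_dotProduct_vec (hident : ∀ k, IdentDistrib (M k) M₀ μ μ₀) (c : ι × ι → ℝ)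
    (k : ℕ) : IdentDistrib (fun ω => c ⬝ᵥ vec (outer (M k) ω)) (fun ω => c ⬝ᵥ vec (outer M₀ ω))
      μ μ₀ :=
  (hident k).comp (measurable_dotProduct_vec c)

omit [IsProbabilityMeasure μ] in
lemma iIndepFun_dotProduct_vec (hindep : iIndepFun M μ) (c : ι × ι → ℝ) :
    iIndepFun (fun k ω => c ⬝ᵥ vec (outer (M k) ω)) μ :=
  hindep.comp (fun _ m => c ⬝ᵥ vec (vecMulVec m m)) fun _ => measurable_dotProduct_vec c

omit [IsProbabilityMeasure μ] in
lemma ae_tendsto_dotProduct_vec_sampleMoment (h4 : ∀ i, MemLp (fun ω => M₀ ω i) 4 μ₀)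
    (hindep : iIndepFun M μ) (hident : ∀ k, IdentDistrib (M k) M₀ μ μ₀) (c : ι × ι → ℝ) :
    ∀ᵐ ω ∂μ, Tendsto (fun n => c ⬝ᵥ vec (sampleMoment M n ω)) atTop
      (𝓝 (c ⬝ᵥ vec (secondMoment M₀ μ₀))) := by
  have hid := identDistrib_dotProduct_vec hident c
  have hint := (memLp_dotProduct_vec_outer h4 c).integrable (by norm_num)
  filter_upwards [strong_law_ae_real (fun k ω => c ⬝ᵥ vec (outer (M k) ω))
    ((hid 0).integrable_iff.2 hint)
    (fun i j hij => (iIndepFun_dotProduct_vec hindep c).indepFun hij)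
    (fun k => (hid k).trans (hid 0).symm)] with ω hω
  rw [(hid 0).integral_eq, integral_dotProduct_vec_outer h4] at hω
  refine hω.congr fun n => ?_
  rw [dotProduct_vec_sampleMoment, div_eq_inv_mul]

omit [IsProbabilityMeasure μ] in
lemma ae_tendsto_sampleMoment [DecidableEq ι] (h4 : ∀ i, MemLp (fun ω => M₀ ω i) 4 μ₀)
    (hindep : iIndepFun M μ) (hident : ∀ k, IdentDistrib (M k) M₀ μ μ₀) :
    ∀ᵐ ω ∂μ, ∀ i j, Tendsto (fun n => sampleMoment M n ω i j) atTop
      (𝓝 (secondMoment M₀ μ₀ i j)) := by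
  refine ae_all_iff.2 fun i => ae_all_iff.2 fun j => ?_
  filter_upwards [ae_tendsto_dotProduct_vec_sampleMoment h4 hindep hident (Pi.single (j, i) 1)]
    with ω hω
  simpa [vec] using hω

lemma tendstoInDistribution_dotProduct_vec (h4 : ∀ i, MemLp (fun ω => M₀ ω i) 4 μ₀)
    (hindep : iIndepFun M μ) (hident : ∀ k, IdentDistrib (M k) M₀ μ μ₀) (c : ι × ι → ℝ) :
    TendstoInDistribution (fun (n : ℕ) ω => √(n : ℝ) *
        (c ⬝ᵥ vec (sampleMoment M n ω) - c ⬝ᵥ vec (secondMoment M₀ μ₀))) atTop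
      (id : ℝ → ℝ) (fun _ => μ)
      (gaussianReal 0 (c ⬝ᵥ (covMat (fun ω => vec (outer M₀ ω)) μ₀ *ᵥ c)).toNNReal) := by
  have hid := identDistrib_dotProduct_vec hident c
  have h := tendstoInDistribution_inv_sqrt_mul_sum_sub (P := μ)
    (Y := (id : ℝ → ℝ)) (X := fun k ω => c ⬝ᵥ vec (outer (M k) ω))
    (P' := gaussianReal 0 (c ⬝ᵥ (covMat (fun ω => vec (outer M₀ ω)) μ₀ *ᵥ c)).toNNReal)
    ⟨aemeasurable_id, by
      rw [Measure.map_id, (hid 0).variance_eq, variance_dotProduct_vec_outer h4]⟩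
    ((hid 0).memLp_iff.2 (memLp_dotProduct_vec_outer h4 c))
    (iIndepFun_dotProduct_vec hindep c) (fun k => (hid k).trans (hid 0).symm)
  -- It remains to pass from the centred sum divided by `√n` to `√n` times the centred mean; both
  -- are 0 at `n = 0`.
  convert h using 3 with n ω
  rw [(hid 0).integral_eq, integral_dotProduct_vec_outer h4, dotProduct_vec_sampleMoment]
  rcases Nat.eq_zero_or_pos n with rfl | hn
  · simp
  · have : (0 : ℝ) < n := by exact_mod_cast hn
    field_simp
    rw [Real.sq_sqrt this.le]

lemma tendstoInMeasure_sqrt_mul_sq_dotProduct_vec (h4 : ∀ i, MemLp (fun ω => M₀ ω i) 4 μ₀)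
    (hindep : iIndepFun M μ) (hident : ∀ k, IdentDistrib (M k) M₀ μ μ₀) {c : ι × ι → ℝ}
    (hc : c ⬝ᵥ vec (secondMoment M₀ μ₀) = 0) :
    TendstoInMeasure μ (fun (n : ℕ) ω => √(n : ℝ) * (c ⬝ᵥ vec (sampleMoment M n ω)) ^ 2)
      atTop (fun _ => 0) := by
  have hid := identDistrib_dotProduct_vec hident c
  simp only [dotProduct_vec_sampleMoment]
  exact tendstoInMeasure_sqrt_mul_sq_mean
    (fun k => (hid k).memLp_iff.2 (memLp_dotProduct_vec_outer h4 c))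
    (fun k => by rw [(hid k).integral_eq, integral_dotProduct_vec_outer h4, hc])
    (iIndepFun_dotProduct_vec hindep c) (fun k => (hid k).trans (hid 0).symm)

omit [Fintype ι] [IsProbabilityMeasure μ] in
lemma aemeasurable_sampleMoment (hM : ∀ k, AEMeasurable (M k) μ) (n : ℕ) (i j : ι) :
    AEMeasurable (fun ω => sampleMoment M n ω i j) μ := by
  have hM' (k : ℕ) (i : ι) : AEMeasurable (fun ω => M k ω i) μ :=
    (measurable_pi_apply i).comp_aemeasurable (hM k)
  simp only [sampleMoment, Matrix.smul_apply, Matrix.sum_apply, outer, vecMulVec_apply]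
  fun_prop

end Sample

/-! ### Negligible remainder and the limit law -/

section Delta

variable {κ : Type*} [Fintype κ] [DecidableEq κ]
  {Ω₀ : Type*} [MeasurableSpace Ω₀] {μ₀ : Measure Ω₀} [IsProbabilityMeasure μ₀]
  {M₀ : Ω₀ → κ ⊕ Unit → ℝ}
  {Ω : Type*} [MeasurableSpace Ω] {μ : Measure Ω} [IsProbabilityMeasure μ]
  {M : ℕ → Ω → κ ⊕ Unit → ℝ}

lemma exists_coeff_normalResidual (θ : κ → ℝ) (i : κ) :
    ∃ c : (κ ⊕ Unit) × (κ ⊕ Unit) → ℝ, ∀ T, normalResidual θ T i = c ⬝ᵥ vec T := by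
  refine exists_coeff_of_linear
    { toFun := fun T => normalResidual θ T i, map_add' := fun S T => ?_, map_smul' := fun a T => ?_ }
  · simp [normalResidual, vecXY, blockXX, toBlocks₁₁, mulVec, dotProduct, add_mul,
      Finset.sum_add_distrib]
    ring
  · simp [normalResidual, vecXY, blockXX, toBlocks₁₁, mulVec, dotProduct, mul_sub,
      Finset.mul_sum, mul_assoc]

/-- The sup distance reaches `ε` only if some coordinate does, so a union bound suffices. Joint
convergence then yields one subsequence serving all coordinates. -/
lemma tendstoInMeasure_pi {α ι' : Type*} [MeasurableSpace α] [Fintype ι'] {ν : Measure α}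
    {f : ℕ → α → ι' → ℝ} {g : α → ι' → ℝ} {l : Filter ℕ}
    (h : ∀ i, TendstoInMeasure ν (fun n x => f n x i) l (fun x => g x i)) :
    TendstoInMeasure ν f l g := by
  intro ε hε
  have hsum : Tendsto (fun n => ∑ i, ν {x | ε ≤ edist (f n x i) (g x i)}) l (𝓝 0) := by
    simpa using tendsto_finsetSum Finset.univ fun i _ => h i ε hε
  refine tendsto_of_tendsto_of_tendsto_of_le_of_le tendsto_const_nhds hsum (fun _ => zero_le)
    fun n => (measure_mono fun x hx => ?_).trans
      (measure_iUnion_fintype_le ν fun i => {x | ε ≤ edist (f n x i) (g x i)})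
  rw [Set.mem_ofPred_eq, edist_pi_def, Finset.le_sup_iff hε] at hx
  simpa using hx

lemma tendstoInMeasure_sqrt_mul_sq_normalResidual (h4 : ∀ i, MemLp (fun ω => M₀ ω i) 4 μ₀)
    (hindep : iIndepFun M μ) (hident : ∀ k, IdentDistrib (M k) M₀ μ μ₀) {θ : κ → ℝ}
    (hθ : normalResidual θ (secondMoment M₀ μ₀) = 0) :
    TendstoInMeasure μ (fun (n : ℕ) ω i => √(n : ℝ) * normalResidual θ (sampleMoment M n ω) i ^ 2)
      atTop (fun _ => 0) := by
  refine tendstoInMeasure_pi fun i => ?_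
  obtain ⟨c, hc⟩ := exists_coeff_normalResidual θ i
  simp only [hc]
  exact tendstoInMeasure_sqrt_mul_sq_dotProduct_vec h4 hindep hident (by rw [← hc, hθ]; rfl)

omit [DecidableEq κ] in
-- Cross terms are controlled by `|r_i r_j| ≤ r_i² + r_j²`. This is the pathwise form of the
-- remainder estimate, with `s = √n` along a subsequence.
lemma tendsto_mul_quadraticForm {s : ℕ → ℝ} (hs : ∀ n, 0 ≤ s n) {r : ℕ → κ → ℝ}
    {B : ℕ → Matrix κ κ ℝ} {B₀ : Matrix κ κ ℝ} (hB : Tendsto B atTop (𝓝 B₀))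
    (hr : Tendsto (fun n i => s n * r n i ^ 2) atTop (𝓝 0)) :
    Tendsto (fun n => s n * (r n ⬝ᵥ (B n *ᵥ r n))) atTop (𝓝 0) := by
  have hr' (i : κ) : Tendsto (fun n => s n * r n i ^ 2) atTop (𝓝 0) :=
    (tendsto_pi_nhds.1 hr) i
  have hrr (i j : κ) : Tendsto (fun n => s n * (r n i * r n j)) atTop (𝓝 0) := by
    refine squeeze_zero_norm (fun n => ?_) (by simpa using (hr' i).add (hr' j))
    rw [norm_mul, Real.norm_of_nonneg (hs n), ← mul_add]
    refine mul_le_mul_of_nonneg_left ?_ (hs n)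
    rw [Real.norm_eq_abs, abs_le]
    constructor <;> nlinarith [sq_nonneg (r n i + r n j), sq_nonneg (r n i - r n j),
      sq_nonneg (r n i), sq_nonneg (r n j)]
  have heq (n : ℕ) : s n * (r n ⬝ᵥ (B n *ᵥ r n)) =
      ∑ i, ∑ j, B n i j * (s n * (r n i * r n j)) := by
    simp only [dotProduct, mulVec, Finset.mul_sum]
    exact Finset.sum_congr rfl fun i _ => Finset.sum_congr rfl fun j _ => by ring
  simp only [heq]
  have hBij (i j : κ) : Tendsto (fun n => B n i j) atTop (𝓝 (B₀ i j)) :=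
    tendsto_pi_nhds.1 (tendsto_pi_nhds.1 hB i) j
  simpa using tendsto_finsetSum Finset.univ fun i _ => tendsto_finsetSum Finset.univ fun j _ =>
    (hBij i j).mul (hrr i j)

omit [Fintype κ] [DecidableEq κ] in
lemma blockXX_transpose_eq {S : Matrix (κ ⊕ Unit) (κ ⊕ Unit) ℝ} (h : Sᵀ = S) :
    (blockXX S)ᵀ = blockXX S := by
  ext i j
  exact congrFun (congrFun h (Sum.inl i)) (Sum.inl j)

omit [IsProbabilityMeasure μ₀] in
lemma plugIn_secondMoment (hS : IsUnit (blockXX (secondMoment M₀ μ₀)).det) {θ : κ → ℝ}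
    (hθ : normalResidual θ (secondMoment M₀ μ₀) = 0) :
    plugIn (secondMoment M₀ μ₀) = linPart θ (secondMoment M₀ μ₀) := by
  rw [plugIn_eq_linPart_add (blockXX_transpose_eq (transpose_secondMoment M₀)) hS θ, hθ]
  simp

/-- Asymptotic normality of the plug-in functional of the sample second moments. -/
theorem tendstoInDistribution_plugIn (h4 : ∀ i, MemLp (fun ω => M₀ ω i) 4 μ₀)
    (hindep : iIndepFun M μ) (hident : ∀ k, IdentDistrib (M k) M₀ μ μ₀)
    (hS : IsUnit (blockXX (secondMoment M₀ μ₀)).det) {θ : κ → ℝ}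
    (hθ : (blockXX (secondMoment M₀ μ₀))⁻¹ *ᵥ vecXY (secondMoment M₀ μ₀) = θ) :
    TendstoInDistribution (fun (n : ℕ) ω => √(n : ℝ) *
        (plugIn (sampleMoment M n ω) - plugIn (secondMoment M₀ μ₀))) atTop
      (id : ℝ → ℝ) (fun _ => μ) (gaussianReal 0 (asympVar M₀ μ₀ θ).toNNReal) := by
  have hres : normalResidual θ (secondMoment M₀ μ₀) = 0 := by
    rw [normalResidual, ← hθ, mulVec_mulVec, mul_nonsing_inv _ hS, one_mulVec, sub_self]
  have hα := alpha_dotProduct_vec (blockXX_transpose_eq (transpose_secondMoment M₀)) hθ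
  have hplug (n : ℕ) : AEMeasurable (fun ω => plugIn (sampleMoment M n ω)) μ :=
    measurable_plugIn.comp_aemeasurable <| aemeasurable_pi_lambda _ fun i =>
      aemeasurable_pi_lambda _ fun j =>
        aemeasurable_sampleMoment (fun k => (hident k).aemeasurable_fst) n i j
  have hmeas (n : ℕ) : AEMeasurable (fun ω => √(n : ℝ) *
      (plugIn (sampleMoment M n ω) - plugIn (secondMoment M₀ μ₀))) μ :=
    ((hplug n).sub_const _).const_mul _
  have hclt := tendstoInDistribution_dotProduct_vec h4 hindep hident
    (alpha (secondMoment M₀ μ₀) θ)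
  refine tendstoInDistribution_of_tendstoInMeasure_sub _ _ hclt ?_ hmeas
  -- The squared residuals converge only in probability, the inverses almost surely. Passing to a
  -- further subsequence makes both almost sure, so the remainder can be treated path by path.
  refine (exists_seq_tendstoInMeasure_atTop_iff fun n =>
    ((hmeas n).sub (hclt.forall_aemeasurable n)).aestronglyMeasurable).2 fun ns hns => ?_
  obtain ⟨ms, hms, hae⟩ := ((tendstoInMeasure_sqrt_mul_sq_normalResidual h4 hindep hident
    hres).comp hns.tendsto_atTop).exists_seq_tendsto_ae
  refine ⟨ms, hms, ?_⟩
  filter_upwards [hae, ae_tendsto_sampleMoment h4 hindep hident] with ω hω hlln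
  have hsub : Tendsto (fun i => ns (ms i)) atTop atTop := (hns.comp hms).tendsto_atTop
  obtain ⟨hinv, hunit⟩ := tendsto_blockXX_inv hS fun i j => (hlln i j).comp hsub
  -- The expansion needs an invertible sample block, which holds only eventually on each path; hence
  -- `congr'`.
  refine (tendsto_mul_quadraticForm (fun n => Real.sqrt_nonneg (ns (ms n) : ℝ)) hinv hω).congr' ?_
  filter_upwards [hunit] with n hn
  simp only [Pi.sub_apply, Function.comp_apply] at hn ⊢
  rw [hα, hα, plugIn_secondMoment hS hres,
    plugIn_eq_linPart_add (blockXX_transpose_eq (transpose_sampleMoment M _ ω)) hn θ]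
  ring

end Delta

/-! ### Normal equations and the reward -/

section LinearModel

variable {ιA J : Type*} {d : J → ℕ} {π : Finset J} {Ω : Type*} [MeasurableSpace Ω]
  {A : Ω → ιA → ℝ} {H : Ω → (j : J) → Fin (d j) → ℝ} {Y : Ω → ℝ}

lemma measurable_stackX (hA : Measurable A) (hH : Measurable H) :
    Measurable (stackX π A H) := by
  refine measurable_pi_lambda _ fun i => ?_
  rcases i with a | q
  · exact (measurable_pi_apply a).comp hA
  · exact (measurable_pi_apply q.2).comp ((measurable_pi_apply q.1.1).comp hH)

variable [Fintype ιA] {μ : Measure Ω} [IsProbabilityMeasure μ]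

omit [MeasurableSpace Ω] in
lemma elim_dotProduct_stackX (γ : ιA → ℝ) (β : ((j : π) × Fin (d j)) → ℝ) (ω : Ω) :
    Sum.elim γ β ⬝ᵥ stackX π A H ω = γ ⬝ᵥ A ω + β ⬝ᵥ fun q => H ω q.1 q.2 := by
  simp [dotProduct, stackX]

/-- The normal equations of the linear model. -/
lemma blockXX_mulVec_eq_vecXY (hA : Measurable A) (hH : Measurable H)
    (h4 : ∀ i, MemLp (fun ω => stackM π A H Y ω i) 4 μ) {θ : XIdx ιA d π → ℝ}
    (hlin : condMean π A H Y μ =ᵐ[μ] fun ω => θ ⬝ᵥ stackX π A H ω) :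
    blockXX (secondMoment (stackM π A H Y) μ) *ᵥ θ = vecXY (secondMoment (stackM π A H Y) μ) := by
  have hX := measurable_stackX (π := π) hA hH
  have hY : Integrable Y μ := (h4 (Sum.inr ())).integrable (by norm_num)
  ext i
  have hXY : Integrable ((fun ω => stackX π A H ω i) * Y) μ :=
    (memLp_outer h4 (Sum.inl i) (Sum.inr ())).integrable (by norm_num)
  have hXi : StronglyMeasurable[MeasurableSpace.comap (stackX π A H) inferInstance]
      fun ω => stackX π A H ω i :=
    ((measurable_pi_apply i).comp (comap_measurable (stackX π A H))).stronglyMeasurable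
  have h1 : ∫ ω, stackX π A H ω i * Y ω ∂μ
      = ∫ ω, stackX π A H ω i * (θ ⬝ᵥ stackX π A H ω) ∂μ := by
    -- Tower property: `X_i` is measurable for the conditioning σ-algebra, so it factors out and `Y`
    -- is replaced by its linear conditional mean.
    have := integral_condExp (μ := μ) (f := (fun ω => stackX π A H ω i) * Y) hX.comap_le
    refine Eq.trans this.symm (integral_congr_ae ?_)
    refine (condExp_mul_of_stronglyMeasurable_left hXi hXY hY).trans ?_
    filter_upwards [hlin] with ω hω
    rw [Pi.mul_apply, ← hω]
    rfl
  have h2 : ∫ ω, stackX π A H ω i * (θ ⬝ᵥ stackX π A H ω) ∂μ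
      = (blockXX (secondMoment (stackM π A H Y) μ) *ᵥ θ) i := by
    simp only [dotProduct, Finset.mul_sum, mulVec]
    rw [integral_finsetSum]
    · refine Finset.sum_congr rfl fun j _ => ?_
      refine Eq.trans (integral_congr_ae (Eventually.of_forall fun ω => ?_))
        (integral_mul_const (θ j) fun ω => outer (stackM π A H Y) ω (Sum.inl i) (Sum.inl j))
      simp only [outer, vecMulVec_apply, stackM, Sum.elim_inl]
      ring
    · intro j _
      have := ((memLp_outer h4 (Sum.inl i) (Sum.inl j)).integrable (by norm_num)).const_mul (θ j)
      refine this.congr (Eventually.of_forall fun ω => ?_)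
      simp only [outer, vecMulVec_apply, stackM, Sum.elim_inl]
      ring
  exact h2.symm.trans h1.symm

lemma reward_eq (h4 : ∀ i, MemLp (fun ω => stackM π A H Y ω i) 4 μ) {θ : XIdx ιA d π → ℝ}
    (hlin : condMean π A H Y μ =ᵐ[μ] fun ω => θ ⬝ᵥ stackX π A H ω) :
    reward π A H Y μ = θ ⬝ᵥ (blockXX (secondMoment (stackM π A H Y) μ) *ᵥ θ) := by
  have h1 : reward π A H Y μ = ∫ ω, (θ ⬝ᵥ stackX π A H ω) ^ 2 ∂μ := by
    refine integral_congr_ae ?_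
    filter_upwards [hlin] with ω hω
    rw [hω]
  have hint (i j : XIdx ιA d π) :
      Integrable (fun ω => θ i * (outer (stackM π A H Y) ω (Sum.inl i) (Sum.inl j) * θ j)) μ :=
    (((memLp_outer h4 _ _).integrable (by norm_num)).mul_const _).const_mul _
  have h2 (ω : Ω) : (θ ⬝ᵥ stackX π A H ω) ^ 2 =
      ∑ i, ∑ j, θ i * (outer (stackM π A H Y) ω (Sum.inl i) (Sum.inl j) * θ j) := by
    rw [sq, dotProduct, Finset.sum_mul_sum]
    refine Finset.sum_congr rfl fun i _ => Finset.sum_congr rfl fun j _ => ?_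
    simp only [outer, vecMulVec_apply, stackM, Sum.elim_inl]
    ring
  rw [h1]
  simp only [h2]
  rw [integral_finsetSum _ fun i _ => integrable_finsetSum _ fun j _ => hint i j]
  simp only [dotProduct, mulVec, Finset.mul_sum]
  refine Finset.sum_congr rfl fun i _ => ?_
  rw [integral_finsetSum _ fun j _ => hint i j]
  refine Finset.sum_congr rfl fun j _ => ?_
  rw [integral_const_mul, integral_mul_const]
  rfl

end LinearModel

end LinReward

theorem mainTheorem3
    {ιA J : Type*} [Fintype ιA] [DecidableEq ιA] [DecidableEq J]
    (d : J → ℕ) (π : Finset J)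
    -- the population variables
    {Ω₀ : Type*} [MeasurableSpace Ω₀] (μ₀ : Measure Ω₀) [IsProbabilityMeasure μ₀]
    (A : Ω₀ → ιA → ℝ) (H : Ω₀ → (j : J) → Fin (d j) → ℝ) (Y : Ω₀ → ℝ)
    (hA : Measurable A) (hH : Measurable H) (hY : Measurable Y)
    (hM4 : ∀ i, MemLp (fun ω => LinReward.stackM π A H Y ω i) 4 μ₀)
    (hS : IsUnit (LinReward.blockXX (LinReward.secondMoment (LinReward.stackM π A H Y) μ₀)))
    -- the linear model for the conditional mean
    (γ : ιA → ℝ) (β : ((j : π) × Fin (d j)) → ℝ)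
    (hlin : LinReward.condMean π A H Y μ₀ =ᵐ[μ₀]
      fun ω => γ ⬝ᵥ A ω + β ⬝ᵥ fun q => H ω q.1 q.2)
    -- the i.i.d. sample
    {Ω : Type*} [MeasurableSpace Ω] (μ : Measure Ω) [IsProbabilityMeasure μ]
    (As : ℕ → Ω → ιA → ℝ) (Hs : ℕ → Ω → (j : J) → Fin (d j) → ℝ) (Ys : ℕ → Ω → ℝ)
    (hindep : iIndepFun (fun k => LinReward.stackM π (As k) (Hs k) (Ys k)) μ)
    (hident : ∀ k, IdentDistrib (LinReward.stackM π (As k) (Hs k) (Ys k))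
      (LinReward.stackM π A H Y) μ μ₀) :
    let S₀ := LinReward.secondMoment (LinReward.stackM π A H Y) μ₀
    let θ : LinReward.XIdx ιA d π → ℝ := Sum.elim γ β
    let R := LinReward.reward π A H Y μ₀
    let σsq := LinReward.asympVar (LinReward.stackM π A H Y) μ₀ θ
    let Rhat := fun (n : ℕ) (ω : Ω) => LinReward.plugIn
      (LinReward.sampleMoment (fun k => LinReward.stackM π (As k) (Hs k) (Ys k)) n ω)
    replicateCol Unit θ = (LinReward.blockXX S₀)⁻¹ * LinReward.blockXY S₀ ∧
    R = θ ⬝ᵥ (LinReward.blockXX S₀ *ᵥ θ) ∧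
    R = LinReward.plugIn S₀ ∧
    0 ≤ σsq ∧
    TendstoInDistribution (fun (n : ℕ) ω => √(n : ℝ) * (Rhat n ω - R)) atTop
      (id : ℝ → ℝ) (fun _ => μ) (gaussianReal 0 σsq.toNNReal) := by
  intro S₀ θ R σsq Rhat
  have hunit : IsUnit (LinReward.blockXX S₀).det := (isUnit_iff_isUnit_det _).1 hS
  have hlin' : LinReward.condMean π A H Y μ₀ =ᵐ[μ₀] fun ω => θ ⬝ᵥ LinReward.stackX π A H ω := by
    simpa only [θ, LinReward.elim_dotProduct_stackX] using hlin
  have hnormal : LinReward.blockXX S₀ *ᵥ θ = LinReward.vecXY S₀ :=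
    LinReward.blockXX_mulVec_eq_vecXY hA hH hM4 hlin'
  have hθ : (LinReward.blockXX S₀)⁻¹ *ᵥ LinReward.vecXY S₀ = θ := by
    rw [← hnormal, mulVec_mulVec, nonsing_inv_mul _ hunit, one_mulVec]
  have hR : R = θ ⬝ᵥ (LinReward.blockXX S₀ *ᵥ θ) := LinReward.reward_eq hM4 hlin'
  have hRplug : R = LinReward.plugIn S₀ := by
    rw [hR, LinReward.plugIn_eq_dotProduct, hθ, hnormal, dotProduct_comm]
  refine ⟨?_, hR, hRplug, ?_, ?_⟩
  · ext i u
    exact (congrFun hθ i).symm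
  -- `σ²` is the variance of the scalar `α ⬝ vec (M Mᵀ)`.
  · exact (variance_nonneg _ _).trans_eq (LinReward.variance_dotProduct_vec_outer hM4 _)
  · have h := LinReward.tendstoInDistribution_plugIn hM4 hindep hident hunit hθ
    rw [← hRplug] at h
    exact h
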